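/- Consider $N$ agents with dynamics $\dot x_i = A x_i + B u_i$, $x_i\in\mathbb R^n$, $u_i\in\mathbb R^m$, which communicate over a finite weighted directed graph with weights $e_{ij}>0$ if there is an edge from $j$ to $i$ and $e_{ij}=0$ otherwise, and which use the control protocol under attack $$u_i = cK\sum_{j} e_{ij}(x_j-x_i) + f_i ,\qquad c>0,$$ where $f_i$ is the attack signal injected into agent $i$. Let $\mathcal L$ be the graph Laplacian (the diagonal matrix of the weighted in-degrees minus the matrix $[e_{ij}]$). Assume that the graph has a directed spanning tree; that $A$ is marginally stable with all eigenvalues on the imaginary axis (so these are semisimple); and that $A-c\lambda BK$ is Hurwitz for every nonzero eigenvalue $\lambda$ of $\mathcal L$. A root node is a node from which every node can be reached by a directed path. Then attacks on non-root nodes cannot destabilize the network, regardless of the number of compromised agents and of the energy of the attack. Precisely, there is a constant $C$, depending only on the graph, $A$, $B$, $K$ and $c$, such that for every attack $f$ with $f_i(t)=0$ for all root nodes $i$ and all $t\ge 0$, and every trajectory $x$ on $[0,\infty)$ under this attack (continuous, and satisfying the differential equation at all but countably many times): 1. if the attack signal is bounded on $[0,\infty)$ (with any bound, and with any, possibly infinite,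 energy), then the states of all agents are bounded on $[0,\infty)$; 2. if $T\ge0$ and $\|f_j(s)\|\le M$ for all $s\in[0,T]$ and all $j$, then $\|x_i(t)\|\le C(\|x(0)\|+M)$ for all $t\in[0,T]$ and all agents $i$; 3. for every such attack, bounded or not, $\|x_i(t)\|\le C\|x(0)\|$ for every root node $i$ and all $t\ge 0$, and the trajectories of the root nodes coincide with those of the attack-free network with the same initial states. Here $\|\cdot\|$ is the maximum norm. -/

import Mathlib

open Matrix Set

/-- A weighted digraph: `weight i j` is the entry `e_ij` of the adjacency matrix, which is positive
if there is an edge from `j` to `i`, and zero otherwise. -/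
structure WeightedDigraph (V : Type*) where
  graph : Digraph V
  weight : Matrix V V ℝ
  weight_pos : ∀ i j, graph.Adj j i → 0 < weight i j
  weight_eq_zero : ∀ i j, ¬ graph.Adj j i → weight i j = 0

/-- `T` is a directed tree with root `r`: every node is reached from `r` by a directed path, `r` has
no incoming edge, and every other node has exactly one incoming edge. -/
def IsDirectedTree {V : Type*} (T : Digraph V) (r : V) : Prop :=
  (∀ v, Relation.ReflTransGen T.Adj r v) ∧ (∀ u, ¬ T.Adj u r) ∧ ∀ v, v ≠ r → ∃! u, T.Adj u v

/-- A subset of the edges forms a directed tree on all the nodes. -/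
def HasSpanningTree {V : Type*} (G : Digraph V) : Prop :=
  ∃ T : Digraph V, (∀ u v, T.Adj u v → G.Adj u v) ∧ ∃ r, IsDirectedTree T r

/-- The root nodes: the nodes from which every node can be reached by a directed path. -/
def rootNodes {V : Type*} (G : Digraph V) : Set V :=
  {r | ∀ v, Relation.ReflTransGen G.Adj r v}

/-- The graph Laplacian `D - E`, with `D` the diagonal matrix of the weighted in-degrees. -/
def WeightedDigraph.laplacian {V : Type*} [Fintype V] [DecidableEq V] (G : WeightedDigraph V) :
    Matrix V V ℝ :=
  Matrix.diagonal (fun i => ∑ j, G.weight i j) - G.weight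

/-- A real matrix regarded as a complex matrix. -/
def complexify {ι κ : Type*} (M : Matrix ι κ ℝ) : Matrix ι κ ℂ :=
  M.map (fun a => (a : ℂ))

/-- All eigenvalues lie in the open left half-plane. -/
def IsHurwitz {ι : Type*} [Fintype ι] [DecidableEq ι] (M : Matrix ι ι ℂ) : Prop :=
  ∀ μ ∈ spectrum ℂ M, μ.re < 0

/-- All eigenvalues lie in the closed left half-plane, and those on the imaginary axis are
semisimple (their Jordan blocks have size one). -/
def IsMarginallyStable {ι : Type*} [Fintype ι] [DecidableEq ι] (M : Matrix ι ι ℂ) : Prop :=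
  ∀ μ ∈ spectrum ℂ M, μ.re ≤ 0 ∧
    (μ.re = 0 → ∀ v : ι → ℂ, ((M - μ • (1 : Matrix ι ι ℂ)) ^ 2) *ᵥ v = 0 →
      (M - μ • (1 : Matrix ι ι ℂ)) *ᵥ v = 0)

/-- The control input `u_i = c K ∑_j e_ij (x_j - x_i) + f_i` of agent `i` under attack, where `x` and
`f` are the current states and attack inputs of all agents. As `e_ij = 0` unless `j` is a neighbor of
`i`, the sum may run over all `j`. -/
noncomputable def controlInput {V : Type*} [Fintype V] {n m : ℕ} (G : WeightedDigraph V) (c : ℝ)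
    (K : Matrix (Fin m) (Fin n) ℝ) (f : V → Fin m → ℝ) (x : V → Fin n → ℝ) (i : V) : Fin m → ℝ :=
  c • (K *ᵥ ∑ j, G.weight i j • (x j - x i)) + f i

/-- `x` is a trajectory on `[0, ∞)` of the agents `x_i' = A x_i + B u_i` under the attack signal `f`:
it is continuous and satisfies the differential equation at all but countably many times, so that
attacks that are switched on and off are covered. -/
def IsTrajectory {V : Type*} [Fintype V] {n m : ℕ} (G : WeightedDigraph V)
    (A : Matrix (Fin n) (Fin n) ℝ) (B : Matrix (Fin n) (Fin m) ℝ) (c : ℝ)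
    (K : Matrix (Fin m) (Fin n) ℝ) (f : ℝ → V → Fin m → ℝ) (x : ℝ → V → Fin n → ℝ) : Prop :=
  ContinuousOn x (Ici 0) ∧
    ∃ S : Set ℝ, S.Countable ∧ ∀ t, 0 < t → t ∉ S → ∀ i,
      HasDerivAt (fun s => x s i) (A *ᵥ x t i + B *ᵥ controlInput G c K (f t) (x t) i) t

/-- The attack is only on non-root nodes. -/
def AttacksOnlyNonRoots {V : Type*} (G : Digraph V) {m : ℕ} (f : ℝ → V → Fin m → ℝ) : Prop :=
  ∀ i ∈ rootNodes G, ∀ t, 0 ≤ t → f t i = 0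

/-- The signals of all agents are bounded on `[0, ∞)`. -/
def StaysBounded {V : Type*} {k : ℕ} (y : ℝ → V → Fin k → ℝ) : Prop :=
  ∃ M : ℝ, ∀ t, 0 ≤ t → ∀ i, ‖y t i‖ ≤ M

/-! Write `M` for the closed-loop operator `I ⊗ A - c L ⊗ B K` on the complexified network states.
It commutes with `L ⊗ I`, so the kernel and the range of `L ⊗ I` are invariant under `M`. By the
maximum principle the kernel consists of consensus states, and a consensus state in the range
vanishes; hence the state space is the direct sum of both. On the kernel `M` acts as `A` at each
node, so its flow is bounded (`ker_le_decaySubmodule`). On the range an eigenvalue of `M` is an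
eigenvalue of some `A - c λ B K` with `λ ≠ 0`, so the flow decays exponentially
(`closedLoop_eigenvalue_re_neg`). The decisive fact is that states vanishing at the roots lie in the
range (`vanishingOnRoots_le_range`). The forcing by an attack on non-roots is such a state, so it
never excites the marginal modes, and Duhamel's formula bounds its effect by its supremum divided by
the decay rate (`norm_sub_expFlow_le`). These states are also invariant under `M`, so the forcing is
never felt at a root. -/

/-! ### Growth and decay of matrix exponentials on invariant subspaces. -/

section Semigroup

variable {E : Type*} [NormedAddCommGroup E] [NormedSpace ℂ E]

/-- The one-parameter semigroup `exp (t M)`. -/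
noncomputable def expFlow (M : E →L[ℂ] E) (t : ℝ) : E →L[ℂ] E :=
  NormedSpace.exp ((t : ℂ) • M)

theorem expFlow_zero (M : E →L[ℂ] E) : expFlow M 0 = 1 := by
  simp [expFlow, NormedSpace.exp_zero]

theorem hasSum_exp_apply [CompleteSpace E] (M : E →L[ℂ] E) (z : E) :
    HasSum (fun n : ℕ => ((n.factorial : ℂ)⁻¹) • (M ^ n) z) (NormedSpace.exp M z) := by
  have h := NormedSpace.exp_series_hasSum_exp' (𝕂 := ℂ) M
  simpa using (ContinuousLinearMap.apply ℂ E z).hasSum h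

theorem expFlow_mem [CompleteSpace E] {M : E →L[ℂ] E} {U : Submodule ℂ E} [FiniteDimensional ℂ U]
    (hU : ∀ z ∈ U, M z ∈ U) {z : E} (hz : z ∈ U) (t : ℝ) : expFlow M t z ∈ U := by
  have hpow : ∀ n : ℕ, (((t : ℂ) • M) ^ n) z ∈ U := by
    intro n
    induction n with
    | zero => simpa using hz
    | succ n ih =>
      rw [pow_succ']
      exact U.smul_mem _ (hU _ ih)
  exact U.closed_of_finiteDimensional.mem_of_tendsto (hasSum_exp_apply ((t : ℂ) • M) z)
    (Filter.Eventually.of_forall fun s => U.sum_mem fun n _ => U.smul_mem _ (hpow n))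

/-- The scalar part `tμ` and `tN`, where `N = M - μ`, commute, and the series of `exp (tN) z` stops
at `k`. -/
theorem expFlow_apply_of_pow_eq_zero [CompleteSpace E] {M : E →L[ℂ] E} {μ : ℂ} {k : ℕ} {z : E}
    (hz : ((M - μ • (1 : E →L[ℂ] E)) ^ k) z = 0) (t : ℝ) :
    expFlow M t z = Complex.exp (t * μ) • ∑ j ∈ Finset.range k,
      ((j.factorial : ℂ)⁻¹ * (t : ℂ) ^ j) • ((M - μ • (1 : E →L[ℂ] E)) ^ j) z := by
  set N : E →L[ℂ] E := M - μ • (1 : E →L[ℂ] E) with hN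
  have hsplit : (t : ℂ) • M = algebraMap ℂ (E →L[ℂ] E) (t * μ) + (t : ℂ) • N := by
    rw [hN, smul_sub, Algebra.algebraMap_eq_smul_one, smul_smul]; abel
  have hz' : ∀ j, j ∉ Finset.range k → (N ^ j) z = 0 := by
    intro j hj
    obtain ⟨i, rfl⟩ := Nat.exists_eq_add_of_le (not_lt.1 (by simpa using hj))
    rw [add_comm, pow_add]
    change (N ^ i) ((N ^ k) z) = 0
    rw [hz, map_zero]
  let _ : NormedAlgebra ℚ (E →L[ℂ] E) := NormedAlgebra.restrictScalars ℚ ℂ _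
  have hexp : expFlow M t = algebraMap ℂ (E →L[ℂ] E) (Complex.exp (t * μ)) *
      NormedSpace.exp ((t : ℂ) • N) := by
    rw [expFlow, hsplit, NormedSpace.exp_add_of_commute (Algebra.commutes _ _),
      ← NormedSpace.algebraMap_exp_comm, Complex.exp_eq_exp_ℂ]
  have hsum : NormedSpace.exp ((t : ℂ) • N) z = ∑ j ∈ Finset.range k,
      ((j.factorial : ℂ)⁻¹ * (t : ℂ) ^ j) • (N ^ j) z := by
    refine (hasSum_exp_apply _ z).unique ?_
    have h := hasSum_sum_of_ne_finset_zero (L := SummationFilter.unconditional ℕ) (s := Finset.range k)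
      (f := fun j : ℕ => ((j.factorial : ℂ)⁻¹ * (t : ℂ) ^ j) • (N ^ j) z)
      (fun j hj => by rw [hz' j hj, smul_zero])
    convert! h using 2 with j
    rw [smul_pow, mul_smul]
    rfl
  rw [hexp, Algebra.algebraMap_eq_smul_one, smul_mul_assoc, one_mul, ← hsum]
  rfl

/-- The vectors whose orbit under `exp (t M)` is `O(exp (-a t))`. -/
def decaySubmodule (M : E →L[ℂ] E) (a : ℝ) : Submodule ℂ E where
  carrier := {z | ∃ C : ℝ, ∀ t : ℝ, 0 ≤ t → ‖expFlow M t z‖ ≤ C * Real.exp (-a * t)}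
  zero_mem' := ⟨0, by simp⟩
  add_mem' := by
    rintro y z ⟨C, hC⟩ ⟨D, hD⟩
    refine ⟨C + D, fun t ht => ?_⟩
    rw [map_add, add_mul]
    exact (norm_add_le _ _).trans (add_le_add (hC t ht) (hD t ht))
  smul_mem' := by
    rintro l z ⟨C, hC⟩
    refine ⟨‖l‖ * C, fun t ht => ?_⟩
    rw [map_smul, norm_smul, mul_assoc]
    exact mul_le_mul_of_nonneg_left (hC t ht) (norm_nonneg _)

/-- The gap `d` between `Re μ` and `-a` absorbs the polynomial factors, since `(d t)^j / j! ≤ exp (d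
t)`. -/
theorem mem_decaySubmodule_of_pow_eq_zero [CompleteSpace E] {M : E →L[ℂ] E} {μ : ℂ} {k : ℕ} {z : E}
    (hz : ((M - μ • (1 : E →L[ℂ] E)) ^ k) z = 0) {a : ℝ} (ha : μ.re < -a) :
    z ∈ decaySubmodule M a := by
  set N : E →L[ℂ] E := M - μ • (1 : E →L[ℂ] E) with hN
  set d : ℝ := -a - μ.re with hd
  have hd0 : 0 < d := by rw [hd]; linarith
  refine ⟨∑ j ∈ Finset.range k, (d ^ j)⁻¹ * ‖(N ^ j) z‖, fun t ht => ?_⟩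
  have hsplit : Real.exp (-a * t) = Real.exp (t * μ.re) * Real.exp (d * t) := by
    rw [← Real.exp_add, hd]; ring_nf
  rw [expFlow_apply_of_pow_eq_zero hz, norm_smul, Complex.norm_exp, hsplit,
    show ((t : ℂ) * μ).re = t * μ.re by simp, mul_left_comm]
  refine mul_le_mul_of_nonneg_left ?_ (Real.exp_pos _).le
  rw [Finset.sum_mul]
  refine (norm_sum_le _ _).trans (Finset.sum_le_sum fun j _ => ?_)
  rw [norm_smul, mul_right_comm]
  refine mul_le_mul_of_nonneg_right ?_ (norm_nonneg _)
  have h := Real.pow_div_factorial_le_exp (d * t) (by positivity) j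
  rw [norm_mul, norm_inv, norm_pow, Complex.norm_natCast, Complex.norm_real, Real.norm_of_nonneg ht]
  rw [le_inv_mul_iff₀ (by positivity)]
  refine le_trans (le_of_eq ?_) h
  rw [mul_pow]; ring

theorem mem_decaySubmodule_zero_of_eigenvector [CompleteSpace E] {M : E →L[ℂ] E} {μ : ℂ} {z : E}
    (hz : (M - μ • (1 : E →L[ℂ] E)) z = 0) (hμ : μ.re = 0) :
    z ∈ decaySubmodule M 0 := by
  refine ⟨‖z‖, fun t _ => ?_⟩
  rw [expFlow_apply_of_pow_eq_zero (k := 1) (by simpa using hz), norm_smul, Complex.norm_exp]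
  simp [hμ]

theorem decaySubmodule_anti (M : E →L[ℂ] E) {a b : ℝ} (hab : a ≤ b) :
    decaySubmodule M b ≤ decaySubmodule M a := by
  rintro z ⟨C, hC⟩
  refine ⟨C, fun t ht => (hC t ht).trans ?_⟩
  have hC0 : 0 ≤ C := by
    have := (norm_nonneg _).trans (hC 0 le_rfl)
    simpa using this
  gcongr

/-- Membership in `decaySubmodule` gives a constant for each vector; the uniform boundedness
principle on `U`, applied to `exp (a t) exp (t M)`, makes it uniform. -/
theorem exists_uniform_decay {M : E →L[ℂ] E} {U : Submodule ℂ E} [FiniteDimensional ℂ U] {a : ℝ}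
    (hU : U ≤ decaySubmodule M a) :
    ∃ C : ℝ, 0 ≤ C ∧ ∀ z ∈ U, ∀ t : ℝ, 0 ≤ t →
      ‖expFlow M t z‖ ≤ C * Real.exp (-a * t) * ‖z‖ := by
  have : CompleteSpace U := FiniteDimensional.complete ℂ U
  have h := banach_steinhaus (ι := Ici (0 : ℝ))
    (g := fun t => (Real.exp (a * t) : ℂ) • (expFlow M t).comp U.subtypeL) (by
      intro z
      obtain ⟨C, hC⟩ := hU z.2
      refine ⟨C, fun t => ?_⟩
      have h := mul_le_mul_of_nonneg_left (hC t t.2) (Real.exp_pos (a * t)).le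
      rw [mul_left_comm, ← Real.exp_add, neg_mul, add_neg_cancel, Real.exp_zero, mul_one] at h
      refine le_trans (le_of_eq ?_) h
      rw [_root_.smul_apply, norm_smul, Complex.norm_real,
        Real.norm_of_nonneg (Real.exp_pos _).le]
      rfl)
  obtain ⟨C, hC⟩ := h
  refine ⟨C, (norm_nonneg _).trans (hC ⟨0, self_mem_Ici⟩), fun z hz t ht => ?_⟩
  have h := ContinuousLinearMap.le_of_opNorm_le _ (hC ⟨t, ht⟩) ⟨z, hz⟩
  rw [_root_.smul_apply, norm_smul, Complex.norm_real,
    Real.norm_of_nonneg (Real.exp_pos _).le] at h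
  change Real.exp (a * t) * ‖expFlow M t z‖ ≤ C * ‖z‖ at h
  rw [neg_mul, Real.exp_neg, mul_right_comm, ← div_eq_mul_inv, le_div_iff₀ (Real.exp_pos _)]
  linarith

/-- An invariant subspace is the sum of its intersections with the generalized eigenspaces. -/
theorem le_of_genEigenvectors_mem [FiniteDimensional ℂ E] {M : E →L[ℂ] E} {U W : Submodule ℂ E}
    (hU : ∀ z ∈ U, M z ∈ U)
    (h : ∀ (μ : ℂ) (k : ℕ), ∀ z ∈ U, ((M - μ • (1 : E →L[ℂ] E)) ^ k) z = 0 → z ∈ W) : U ≤ W := by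
  rw [Submodule.eq_iSup_inf_genEigenspace (f := (M : Module.End ℂ E)) (p := U) ⊤ hU
    (Module.End.iSup_maxGenEigenspace_eq_top _)]
  refine iSup_le fun μ => ?_
  rintro z ⟨hzU, hz⟩
  obtain ⟨k, hk⟩ := Module.End.mem_maxGenEigenspace _ _ _ |>.1 hz
  refine h μ k z hzU ?_
  rw [← hk]
  have : ((M - μ • (1 : E →L[ℂ] E) : E →L[ℂ] E) : Module.End ℂ E) = (M : Module.End ℂ E) - μ • 1 := rfl
  rw [← this, ← ContinuousLinearMap.toLinearMap_pow]
  rfl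

/-- The last nonzero vector among the iterates of `M - μ` on `z` is an eigenvector. -/
theorem exists_eigenvector_of_pow_eq_zero {M : E →L[ℂ] E} {U : Submodule ℂ E}
    (hU : ∀ z ∈ U, M z ∈ U) {μ : ℂ} {k : ℕ} {z : E} (hzU : z ∈ U) (hz0 : z ≠ 0)
    (hz : ((M - μ • (1 : E →L[ℂ] E)) ^ k) z = 0) : ∃ w ∈ U, w ≠ 0 ∧ M w = μ • w := by
  induction k generalizing z with
  | zero => exact absurd (by simpa using hz) hz0
  | succ k ih =>
    by_cases h : (M - μ • (1 : E →L[ℂ] E)) z = 0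
    · exact ⟨z, hzU, hz0, by simpa [sub_eq_zero] using h⟩
    · exact ih (U.sub_mem (hU z hzU) (U.smul_mem _ hzU)) h (by rw [pow_succ] at hz; exact hz)

theorem exists_decay_of_eigenvalues_re_neg [FiniteDimensional ℂ E] {M : E →L[ℂ] E} {U : Submodule ℂ E}
    (hU : ∀ z ∈ U, M z ∈ U) (h : ∀ (μ : ℂ), ∀ z ∈ U, z ≠ 0 → M z = μ • z → μ.re < 0) :
    ∃ a : ℝ, 0 < a ∧ U ≤ decaySubmodule M a := by
  have : CompleteSpace E := FiniteDimensional.complete ℂ E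
  have hfin : {μ : ℂ | ∃ z ∈ U, z ≠ 0 ∧ M z = μ • z}.Finite := by
    refine (Module.End.finite_hasEigenvalue (M : Module.End ℂ E)).subset ?_
    rintro μ ⟨z, -, hz0, hz⟩
    exact Module.End.hasEigenvalue_of_hasEigenvector ⟨Module.End.mem_eigenspace_iff.2 hz, hz0⟩
  have ha : ∃ a : ℝ, 0 < a ∧ ∀ μ ∈ {μ : ℂ | ∃ z ∈ U, z ≠ 0 ∧ M z = μ • z}, μ.re < -a := by
    have hneg : ∀ μ ∈ {μ : ℂ | ∃ z ∈ U, z ≠ 0 ∧ M z = μ • z}, μ.re < 0 := by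
      rintro μ ⟨z, hzU, hz0, hz⟩
      exact h μ z hzU hz0 hz
    generalize {μ : ℂ | ∃ z ∈ U, z ≠ 0 ∧ M z = μ • z} = S at hfin hneg
    rcases S.eq_empty_or_nonempty with rfl | hne
    · exact ⟨1, one_pos, by simp⟩
    · obtain ⟨m, hm, hmax⟩ := hfin.exists_maximalFor Complex.re S hne
      have hm' := hneg m hm
      -- Half the spectral gap: the inequality must be strict to leave room for the polynomial
      -- factors.
      refine ⟨-m.re / 2, by linarith, fun μ hμ => ?_⟩
      have : μ.re ≤ m.re := by
        by_contra hlt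
        exact hlt (hmax hμ (not_le.1 hlt).le)
      linarith
  obtain ⟨a, ha0, ha⟩ := ha
  refine ⟨a, ha0, le_of_genEigenvectors_mem hU fun μ k z hzU hz => ?_⟩
  by_cases hz0 : z = 0
  · rw [hz0]; exact Submodule.zero_mem _
  · exact mem_decaySubmodule_of_pow_eq_zero hz
      (ha μ (exists_eigenvector_of_pow_eq_zero hU hzU hz0 hz))

theorem le_decaySubmodule_zero_of_semisimple [FiniteDimensional ℂ E] {M : E →L[ℂ] E} {U : Submodule ℂ E}
    (hU : ∀ z ∈ U, M z ∈ U)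
    (h : ∀ (μ : ℂ), ∀ z ∈ U, z ≠ 0 → M z = μ • z → μ.re = 0)
    (hss : ∀ (μ : ℂ), μ.re = 0 → ∀ z ∈ U, ((M - μ • (1 : E →L[ℂ] E)) ^ 2) z = 0 →
      (M - μ • (1 : E →L[ℂ] E)) z = 0) :
    U ≤ decaySubmodule M 0 := by
  have : CompleteSpace E := FiniteDimensional.complete ℂ E
  refine le_of_genEigenvectors_mem hU fun μ k z hzU hz => ?_
  by_cases hz0 : z = 0
  · rw [hz0]; exact Submodule.zero_mem _
  obtain ⟨w, hwU, hw0, hw⟩ := exists_eigenvector_of_pow_eq_zero hU hzU hz0 hz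
  have hμ := h μ w hwU hw0 hw
  refine mem_decaySubmodule_zero_of_eigenvector ?_ hμ
  -- The induction passes from `z` to `(M - μ) z`, which may vanish.
  clear hz0
  induction k generalizing z with
  | zero => rw [show z = 0 by simpa using hz, map_zero]
  | succ k ih =>
    refine hss μ hμ z hzU ?_
    rw [pow_succ] at hz
    rw [pow_two]
    exact ih _ (U.sub_mem (hU z hzU) (U.smul_mem _ hzU)) hz

end Semigroup

/-! ### Duhamel's formula for forced trajectories. -/

section Duhamel

variable {E : Type*} [NormedAddCommGroup E] [NormedSpace ℂ E]

theorem hasDerivAt_expFlow [CompleteSpace E] (M : E →L[ℂ] E) (t : ℝ) :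
    HasDerivAt (expFlow M) (expFlow M t * M) t := by
  have h := (hasDerivAt_exp_smul_const (𝕂 := ℂ) M (t : ℂ)).scomp t Complex.ofRealCLM.hasDerivAt
  simpa [expFlow, Function.comp_def] using! h

/-- Variation of constants: the two terms containing `M (x s)` cancel. -/
theorem hasDerivAt_expFlow_sub_apply [CompleteSpace E] {M : E →L[ℂ] E} {x : ℝ → E} {t s : ℝ} {g : E}
    (hx : HasDerivAt x (M (x s) + g) s) :
    HasDerivAt (fun r => expFlow M (t - r) (x r)) (expFlow M (t - s) g) s := by
  have h1 : HasDerivAt (fun r : ℝ => expFlow M (t - r)) (-(expFlow M (t - s) * M)) s := by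
    simpa using! (hasDerivAt_expFlow M (t - s)).scomp s ((hasDerivAt_id s).const_sub t)
  have h2 := ((ContinuousLinearMap.restrictScalarsL ℂ E E ℝ ℝ).hasFDerivAt.comp_hasDerivAt s
    h1).clm_apply hx
  refine h2.congr_deriv ?_
  change -(expFlow M (t - s) (M (x s))) + expFlow M (t - s) (M (x s) + g) = _
  rw [map_add]; abel

theorem continuousOn_expFlow_sub_apply [CompleteSpace E] (M : E →L[ℂ] E) {x : ℝ → E} {t : ℝ}
    {s : Set ℝ} (hx : ContinuousOn x s) : ContinuousOn (fun r => expFlow M (t - r) (x r)) s := by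
  have h : Continuous (expFlow M) :=
    continuous_iff_continuousAt.2 fun r => (hasDerivAt_expFlow M r).continuousAt
  exact (h.comp (continuous_const.sub continuous_id)).continuousOn.clm_apply hx

/-- Components that are blind to the values of the forcing are transported by the free flow. -/
theorem map_eq_map_expFlow_of_forcing_mem [CompleteSpace E] {F : Type*} [NormedAddCommGroup F]
    [NormedSpace ℂ F] [CompleteSpace F] {M : E →L[ℂ] E}
    {U : Submodule ℂ E} [FiniteDimensional ℂ U] (hU : ∀ z ∈ U, M z ∈ U)
    (φ : E →L[ℂ] F) (hφ : ∀ z ∈ U, φ z = 0)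
    {x g : ℝ → E} {t : ℝ} (ht : 0 ≤ t) {S : Set ℝ} (hS : S.Countable)
    (hx : ContinuousOn x (Icc 0 t))
    (hd : ∀ s ∈ Ioo 0 t \ S, HasDerivAt x (M (x s) + g s) s)
    (hg : ∀ s ∈ Ioo 0 t, g s ∈ U) : φ (x t) = φ (expFlow M t (x 0)) := by
  -- The derivative is `φ` of a vector in the invariant `U`, hence zero, so `g` needs neither a
  -- bound nor integrability.
  have h := MeasureTheory.integral_eq_of_hasDerivAt_off_countable_of_le
    (fun s => φ (expFlow M (t - s) (x s))) (fun _ => 0) ht hS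
    (φ.continuous.comp_continuousOn (continuousOn_expFlow_sub_apply M hx))
    (fun s hs => by
      have h1 := (φ.restrictScalars ℝ).hasFDerivAt.comp_hasDerivAt s
        (hasDerivAt_expFlow_sub_apply (t := t) (hd s hs))
      refine h1.congr_deriv ?_
      exact hφ _ (expFlow_mem hU (hg s hs.1) _))
    intervalIntegrable_const
  simp only [intervalIntegral.integral_zero, sub_self, sub_zero, expFlow_zero] at h
  exact sub_eq_zero.1 h.symm

theorem norm_sub_expFlow_le [FiniteDimensional ℂ E] {M : E →L[ℂ] E} {U : Submodule ℂ E}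
    {C a D : ℝ} (hC : 0 ≤ C) (ha : 0 < a) (hD : 0 ≤ D)
    (hdecay : ∀ z ∈ U, ∀ t : ℝ, 0 ≤ t → ‖expFlow M t z‖ ≤ C * Real.exp (-a * t) * ‖z‖)
    {x g : ℝ → E} {t : ℝ} (ht : 0 ≤ t) {S : Set ℝ} (hS : S.Countable)
    (hx : ContinuousOn x (Icc 0 t))
    (hd : ∀ s ∈ Ioo 0 t \ S, HasDerivAt x (M (x s) + g s) s)
    (hg : ∀ s ∈ Icc 0 t, g s ∈ U) (hgD : ∀ s ∈ Icc 0 t, ‖g s‖ ≤ D) :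
    ‖x t - expFlow M t (x 0)‖ ≤ C * D / a := by
  have : CompleteSpace E := FiniteDimensional.complete ℂ E
  have hd' : ∀ s ∈ Ioo 0 t \ S,
      HasDerivAt (fun r => expFlow M (t - r) (x r)) (expFlow M (t - s) (g s)) s :=
    fun s hs => hasDerivAt_expFlow_sub_apply (hd s hs)
  have hbound : ∀ s ∈ Icc 0 t,
      ‖expFlow M (t - s) (g s)‖ ≤ C * D * Real.exp (-a * (t - s)) := by
    intro s hs
    refine (hdecay _ (hg s hs) _ (sub_nonneg.2 hs.2)).trans ?_
    rw [mul_right_comm]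
    gcongr
    exact hgD s hs
  have hder : ∀ s : ℝ, HasDerivAt (fun s => C * D / a * Real.exp (-a * (t - s)))
      (C * D * Real.exp (-a * (t - s))) s := by
    intro s
    have h1 : HasDerivAt (fun s : ℝ => -a * (t - s)) a s := by
      simpa using ((hasDerivAt_id s).const_sub t).const_mul (-a)
    refine (h1.exp.const_mul (C * D / a)).congr_deriv ?_
    field_simp
  have hbint : IntervalIntegrable (fun s => C * D * Real.exp (-a * (t - s)))
      MeasureTheory.volume 0 t := Continuous.intervalIntegrable (by fun_prop) _ _
  have hae : ∀ᵐ s ∂(MeasureTheory.volume : MeasureTheory.Measure ℝ), s ∉ insert t S :=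
    (hS.insert t).ae_notMem _
  -- Measurability of `g` is not assumed: the integrand agrees almost everywhere with a derivative,
  -- which is measurable.
  have hint : IntervalIntegrable (fun s => expFlow M (t - s) (g s)) MeasureTheory.volume 0 t := by
    refine hbint.mono_fun ?_ ?_
    · refine (aestronglyMeasurable_deriv (fun r => expFlow M (t - r) (x r)) _).congr ?_
      rw [uIoc_of_le ht]
      filter_upwards [MeasureTheory.ae_restrict_mem measurableSet_Ioc,
        MeasureTheory.ae_restrict_of_ae hae] with s hs hsS
      rw [mem_insert_iff, not_or] at hsS
      exact (hd' s ⟨⟨hs.1, lt_of_le_of_ne hs.2 hsS.1⟩, hsS.2⟩).deriv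
    · rw [uIoc_of_le ht]
      filter_upwards [MeasureTheory.ae_restrict_mem measurableSet_Ioc] with s hs
      refine (hbound s ⟨hs.1.le, hs.2⟩).trans (le_of_eq ?_)
      rw [Real.norm_of_nonneg (by positivity)]
  have h := MeasureTheory.integral_eq_of_hasDerivAt_off_countable_of_le _ _ ht hS
    (continuousOn_expFlow_sub_apply M hx) hd' hint
  have h' : ∫ s in (0 : ℝ)..t, C * D * Real.exp (-a * (t - s)) =
      C * D / a - C * D / a * Real.exp (-a * t) := by
    rw [intervalIntegral.integral_eq_sub_of_hasDerivAt (fun s _ => hder s) hbint]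
    simp
  simp only [sub_self, sub_zero, expFlow_zero] at h
  change _ = x t - _ at h
  rw [← h]
  refine (intervalIntegral.norm_integral_le_of_norm_le ht (Filter.Eventually.of_forall
    fun s hs => hbound s ⟨hs.1.le, hs.2⟩) hbint).trans ?_
  rw [h']
  have : 0 ≤ C * D / a * Real.exp (-a * t) := by positivity
  linarith

end Duhamel

/-! ### Kernel and range of the graph Laplacian. -/

section Laplacian

variable {V : Type*}

theorem WeightedDigraph.weight_nonneg (G : WeightedDigraph V) (i j : V) : 0 ≤ G.weight i j := by
  by_cases h : G.graph.Adj j i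
  · exact (G.weight_pos i j h).le
  · exact (G.weight_eq_zero i j h).ge

theorem HasSpanningTree.rootNodes_nonempty {G : Digraph V} (h : HasSpanningTree G) :
    (rootNodes G).Nonempty := by
  obtain ⟨T, hT, r, hr, -⟩ := h
  exact ⟨r, fun v => Relation.ReflTransGen.mono hT _ _ (hr v)⟩

theorem mem_rootNodes_of_adj {G : Digraph V} {i j : V} (hi : i ∈ rootNodes G) (h : G.Adj j i) :
    j ∈ rootNodes G :=
  fun v => (hi v).head h

variable [Fintype V]

/-- The network disagreement `∑ j, e_ij (v_i - v_j)`, that is, the Laplacian acting on vectors with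
entries in a module. -/
noncomputable def WeightedDigraph.lapMap (G : WeightedDigraph V) (F : Type*) [AddCommGroup F]
    [Module ℂ F] : (V → F) →ₗ[ℂ] (V → F) where
  toFun v i := ∑ j, (G.weight i j : ℂ) • (v i - v j)
  map_add' v w := by
    ext i
    simp only [Pi.add_apply, ← Finset.sum_add_distrib, ← smul_add]
    exact Finset.sum_congr rfl fun j _ => by congr 1; abel
  map_smul' l v := by
    ext i
    simp only [Pi.smul_apply, RingHom.id_apply, Finset.smul_sum, ← smul_sub]
    exact Finset.sum_congr rfl fun j _ => smul_comm _ _ _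

theorem WeightedDigraph.lapMap_apply (G : WeightedDigraph V) {F : Type*} [AddCommGroup F]
    [Module ℂ F] (v : V → F) (i : V) :
    G.lapMap F v i = ∑ j, (G.weight i j : ℂ) • (v i - v j) := rfl

theorem WeightedDigraph.complexify_laplacian_mulVec [DecidableEq V] (G : WeightedDigraph V)
    (v : V → ℂ) : complexify G.laplacian *ᵥ v = G.lapMap ℂ v := by
  have h : complexify G.laplacian =
      Matrix.diagonal (fun i => ∑ j, (G.weight i j : ℂ)) - complexify G.weight := by
    ext i j
    by_cases hij : i = j
    · subst hij; simp [complexify, laplacian]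
    · simp [complexify, laplacian, hij]
  ext i
  rw [h, sub_mulVec, Pi.sub_apply, mulVec_diagonal, Finset.sum_mul]
  simp only [complexify, mulVec, dotProduct, map_apply, lapMap_apply, smul_eq_mul, mul_sub,
    Finset.sum_sub_distrib]

theorem WeightedDigraph.lapMap_comp (G : WeightedDigraph V) {F F' : Type*} [AddCommGroup F]
    [Module ℂ F] [AddCommGroup F'] [Module ℂ F'] (φ : F →ₗ[ℂ] F') (v : V → F) :
    G.lapMap F' (fun i => φ (v i)) = fun i => φ (G.lapMap F v i) := by
  ext i
  simp [lapMap_apply, map_sum]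

/-- The maximum principle: a subharmonic function takes its maximum at the root nodes. -/
theorem WeightedDigraph.le_root_of_subharmonic (G : WeightedDigraph V) {v : V → ℝ}
    (hv : ∀ i, ∑ j, G.weight i j * (v i - v j) ≤ 0) {r : V} (hr : r ∈ rootNodes G.graph) (i : V) :
    v i ≤ v r := by
  have : Nonempty V := ⟨r⟩
  obtain ⟨m, hm⟩ := Finite.exists_max v
  -- At a maximal node all summands are nonnegative, so they vanish: the maximum propagates
  -- backwards along edges, up to the root.
  have key : ∀ u, Relation.ReflTransGen G.graph.Adj u m → v u = v m := by
    intro u hu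
    induction hu using Relation.ReflTransGen.head_induction_on with
    | refl => rfl
    | @head j k hjk _ ih =>
      have hnn : ∀ l ∈ Finset.univ, 0 ≤ G.weight k l * (v k - v l) := fun l _ =>
        mul_nonneg (G.weight_nonneg k l) (by rw [ih]; linarith [hm l])
      have h0 := le_antisymm (hv k) (Finset.sum_nonneg hnn)
      have h1 := (Finset.sum_eq_zero_iff_of_nonneg hnn).1 h0 j (Finset.mem_univ _)
      have h2 := (mul_eq_zero.1 h1).resolve_left (G.weight_pos k j hjk).ne'
      linarith
  rw [key r (hr m)]
  exact hm i

theorem WeightedDigraph.eq_root_of_harmonic (G : WeightedDigraph V) {v : V → ℝ}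
    (hv : ∀ i, ∑ j, G.weight i j * (v i - v j) = 0) {r : V} (hr : r ∈ rootNodes G.graph) (i : V) :
    v i = v r := by
  refine le_antisymm (G.le_root_of_subharmonic (fun k => (hv k).le) hr i) ?_
  have h := G.le_root_of_subharmonic (v := fun k => -v k) (fun k => ?_) hr i
  · linarith
  · refine le_of_eq ?_
    rw [← neg_zero, ← hv k, ← Finset.sum_neg_distrib]
    exact Finset.sum_congr rfl fun j _ => by ring

/-- A constant in the range of the Laplacian vanishes. -/
theorem WeightedDigraph.eq_zero_of_const_laplacian [Nonempty V] (G : WeightedDigraph V) {v : V → ℝ}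
    {a : ℝ} (hv : ∀ i, ∑ j, G.weight i j * (v i - v j) = a) : a = 0 := by
  obtain ⟨p, hp⟩ := Finite.exists_max v
  obtain ⟨q, hq⟩ := Finite.exists_min v
  -- The sum is nonpositive at a minimum of `v` and nonnegative at a maximum.
  refine le_antisymm ?_ ?_
  · rw [← hv q]
    exact Finset.sum_nonpos fun j _ =>
      mul_nonpos_of_nonneg_of_nonpos (G.weight_nonneg q j) (by linarith [hq j])
  · rw [← hv p]
    exact Finset.sum_nonneg fun j _ => mul_nonneg (G.weight_nonneg p j) (by linarith [hp j])

theorem WeightedDigraph.lapMap_re (G : WeightedDigraph V) (v : V → ℂ) (i : V) :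
    (G.lapMap ℂ v i).re = ∑ j, G.weight i j * ((v i).re - (v j).re) := by
  simp [lapMap_apply]

theorem WeightedDigraph.lapMap_im (G : WeightedDigraph V) (v : V → ℂ) (i : V) :
    (G.lapMap ℂ v i).im = ∑ j, G.weight i j * ((v i).im - (v j).im) := by
  simp [lapMap_apply]

variable {n : ℕ}

theorem WeightedDigraph.lapMap_pi_apply (G : WeightedDigraph V) (z : V → Fin n → ℂ) (i : V)
    (k : Fin n) : G.lapMap (Fin n → ℂ) z i k = G.lapMap ℂ (fun j => z j k) i :=
  (congrFun (G.lapMap_comp (LinearMap.proj k : (Fin n → ℂ) →ₗ[ℂ] ℂ) z) i).symm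

theorem WeightedDigraph.eq_root_of_lapMap_eq_zero (G : WeightedDigraph V) {z : V → Fin n → ℂ}
    (hz : G.lapMap _ z = 0) {r : V} (hr : r ∈ rootNodes G.graph) (i : V) : z i = z r := by
  have h : ∀ k j, G.lapMap ℂ (fun j => z j k) j = 0 := fun k j => by
    rw [← G.lapMap_pi_apply, hz]; rfl
  ext k
  apply Complex.ext
  · exact G.eq_root_of_harmonic (v := fun j => (z j k).re)
      (fun j => by rw [← G.lapMap_re (fun j => z j k), h]; rfl) hr i
  · exact G.eq_root_of_harmonic (v := fun j => (z j k).im)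
      (fun j => by rw [← G.lapMap_im (fun j => z j k), h]; rfl) hr i

/-- This is semisimplicity of the eigenvalue zero: kernel elements are constant over the nodes, and
a constant in the range is zero. -/
theorem WeightedDigraph.disjoint_ker_range_lapMap (G : WeightedDigraph V)
    (hG : HasSpanningTree G.graph) :
    Disjoint (LinearMap.ker (G.lapMap (Fin n → ℂ))) (LinearMap.range (G.lapMap (Fin n → ℂ))) := by
  obtain ⟨r, hr⟩ := hG.rootNodes_nonempty
  have : Nonempty V := ⟨r⟩
  rw [Submodule.disjoint_def]
  rintro _ hker ⟨y, rfl⟩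
  have hconst := G.eq_root_of_lapMap_eq_zero (LinearMap.mem_ker.1 hker) hr
  have h0 : G.lapMap _ y r = 0 := by
    ext k
    apply Complex.ext
    · exact G.eq_zero_of_const_laplacian (v := fun j => (y j k).re) fun j => by
        rw [← G.lapMap_re (fun j => y j k), ← G.lapMap_pi_apply, hconst j]
    · exact G.eq_zero_of_const_laplacian (v := fun j => (y j k).im) fun j => by
        rw [← G.lapMap_im (fun j => y j k), ← G.lapMap_pi_apply, hconst j]
  ext1 i
  rw [hconst i, h0]; rfl

theorem WeightedDigraph.ker_sup_range_lapMap (G : WeightedDigraph V)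
    (hG : HasSpanningTree G.graph) :
    LinearMap.ker (G.lapMap (Fin n → ℂ)) ⊔ LinearMap.range (G.lapMap (Fin n → ℂ)) = ⊤ := by
  refine Submodule.eq_top_of_disjoint _ _ ?_ (G.disjoint_ker_range_lapMap hG)
  rw [add_comm, LinearMap.finrank_range_add_finrank_ker]

/-- The states that vanish at all root nodes. -/
def WeightedDigraph.vanishingOnRoots (G : WeightedDigraph V) (F : Type*) [AddCommGroup F]
    [Module ℂ F] : Submodule ℂ (V → F) where
  carrier := {z | ∀ i ∈ rootNodes G.graph, z i = 0}
  zero_mem' _ _ := rfl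
  add_mem' hy hz i hi := by rw [Pi.add_apply, hy i hi, hz i hi, add_zero]
  smul_mem' l z hz i hi := by rw [Pi.smul_apply, hz i hi, smul_zero]

/-- All in-neighbors of a root are roots. -/
theorem WeightedDigraph.lapMap_mem_vanishingOnRoots (G : WeightedDigraph V) {F : Type*}
    [AddCommGroup F] [Module ℂ F] {z : V → F} (hz : z ∈ G.vanishingOnRoots F) :
    G.lapMap F z ∈ G.vanishingOnRoots F := by
  intro i hi
  refine Finset.sum_eq_zero fun j _ => ?_
  by_cases h : G.graph.Adj j i
  · rw [hz i hi, hz j (mem_rootNodes_of_adj hi h), sub_self, smul_zero]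
  · rw [G.weight_eq_zero i j h, Complex.ofReal_zero, zero_smul]

/-- The Laplacian maps this subspace to itself, injectively because a consensus state that vanishes
at a root is zero; in finite dimension it is then onto. -/
theorem WeightedDigraph.vanishingOnRoots_le_range (G : WeightedDigraph V)
    (hG : HasSpanningTree G.graph) :
    G.vanishingOnRoots (Fin n → ℂ) ≤ LinearMap.range (G.lapMap (Fin n → ℂ)) := by
  obtain ⟨r, hr⟩ := hG.rootNodes_nonempty
  let f := (G.lapMap (Fin n → ℂ)).restrict (p := G.vanishingOnRoots (Fin n → ℂ))
    (q := G.vanishingOnRoots (Fin n → ℂ)) fun z hz => G.lapMap_mem_vanishingOnRoots hz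
  have hinj : Function.Injective f := by
    refine (injective_iff_map_eq_zero f).2 fun z hz => ?_
    have h0 : G.lapMap _ z.1 = 0 := congrArg Subtype.val hz
    ext1
    ext1 i
    rw [G.eq_root_of_lapMap_eq_zero h0 hr i, z.2 r hr]; rfl
  intro z hz
  obtain ⟨y, hy⟩ := LinearMap.surjective_of_injective hinj ⟨z, hz⟩
  exact ⟨y.1, congrArg Subtype.val hy⟩

end Laplacian

/-! ### Complexified matrices and joint eigenvectors. -/

theorem complexify_mulVec {p q : ℕ} (M : Matrix (Fin p) (Fin q) ℝ) (v : Fin q → ℝ) (k : Fin p) :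
    (complexify M *ᵥ fun l => (v l : ℂ)) k = ((M *ᵥ v) k : ℝ) := by
  simp [complexify, mulVec, dotProduct]

theorem mem_spectrum_of_mulVec_eq_smul {ι : Type*} [Fintype ι] [DecidableEq ι] {M : Matrix ι ι ℂ}
    {μ : ℂ} {v : ι → ℂ} (hv : v ≠ 0) (h : M *ᵥ v = μ • v) : μ ∈ spectrum ℂ M := by
  rw [← Matrix.spectrum_toLin']
  refine (Module.End.hasEigenvalue_of_hasEigenvector (x := v)
    ⟨Module.End.mem_eigenspace_iff.2 ?_, hv⟩).mem_spectrum
  rwa [Matrix.toLin'_apply]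

/-- Commuting endomorphisms of a nonzero finite-dimensional space: an eigenvector of the first in an
invariant subspace of the second can be replaced by a joint eigenvector in this subspace. -/
theorem exists_joint_eigenvector {E : Type*} [AddCommGroup E] [Module ℂ E] [FiniteDimensional ℂ E]
    {S T : E →ₗ[ℂ] E} (hcomm : ∀ z, T (S z) = S (T z)) {U : Submodule ℂ E}
    (hU : ∀ z ∈ U, T z ∈ U) {μ : ℂ} {z : E} (hzU : z ∈ U) (hz0 : z ≠ 0) (hz : S z = μ • z) :
    ∃ l : ℂ, ∃ w ∈ U, w ≠ 0 ∧ S w = μ • w ∧ T w = l • w := by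
  let W : Submodule ℂ E := U ⊓ Module.End.eigenspace S μ
  have hW : ∀ w ∈ W, T w ∈ W := by
    rintro w ⟨hwU, hw⟩
    refine ⟨hU w hwU, Module.End.mem_eigenspace_iff.2 ?_⟩
    rw [← hcomm, Module.End.mem_eigenspace_iff.1 hw, map_smul]
  have : Nontrivial W := ⟨⟨z, hzU, Module.End.mem_eigenspace_iff.2 hz⟩, 0,
    fun h => hz0 (congrArg Subtype.val h)⟩
  obtain ⟨l, hl⟩ := Module.End.exists_eigenvalue (T.restrict hW)
  obtain ⟨w, hw, hw0⟩ := hl.exists_hasEigenvector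
  refine ⟨l, w, w.2.1, fun h => hw0 (Subtype.ext h), Module.End.mem_eigenspace_iff.1 w.2.2, ?_⟩
  exact congrArg Subtype.val (Module.End.mem_eigenspace_iff.1 hw)

/-! ### Spectral analysis of the closed-loop operator. -/

section ClosedLoop

variable {V : Type*} [Fintype V] {n m : ℕ}

/-- The system operator `I ⊗ A - c L ⊗ B K` of the network. -/
noncomputable def closedLoop (G : WeightedDigraph V) (A : Matrix (Fin n) (Fin n) ℝ)
    (B : Matrix (Fin n) (Fin m) ℝ) (c : ℝ) (K : Matrix (Fin m) (Fin n) ℝ) :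
    (V → Fin n → ℂ) →L[ℂ] (V → Fin n → ℂ) :=
  LinearMap.toContinuousLinearMap ((complexify A).mulVecLin.compLeft V -
    ((c : ℂ) • (complexify (B * K)).mulVecLin).compLeft V ∘ₗ G.lapMap (Fin n → ℂ))

variable (G : WeightedDigraph V) (A : Matrix (Fin n) (Fin n) ℝ)
    (B : Matrix (Fin n) (Fin m) ℝ) (c : ℝ) (K : Matrix (Fin m) (Fin n) ℝ)

theorem closedLoop_apply (z : V → Fin n → ℂ) (i : V) :
    closedLoop G A B c K z i =
      complexify A *ᵥ z i - (c : ℂ) • (complexify (B * K) *ᵥ G.lapMap (Fin n → ℂ) z i) := rfl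

theorem lapMap_closedLoop (z : V → Fin n → ℂ) :
    G.lapMap _ (closedLoop G A B c K z) = closedLoop G A B c K (G.lapMap _ z) := by
  have h : closedLoop G A B c K z = (fun i => (complexify A).mulVecLin (z i)) -
      fun i => ((c : ℂ) • (complexify (B * K)).mulVecLin) (G.lapMap (Fin n → ℂ) z i) := rfl
  rw [h, map_sub, G.lapMap_comp, G.lapMap_comp]
  rfl

theorem closedLoop_mem_ker {z : V → Fin n → ℂ}
    (hz : z ∈ LinearMap.ker (G.lapMap (Fin n → ℂ))) :
    closedLoop G A B c K z ∈ LinearMap.ker (G.lapMap (Fin n → ℂ)) := by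
  rw [LinearMap.mem_ker] at hz ⊢
  rw [lapMap_closedLoop, hz, map_zero]

theorem closedLoop_mem_range {z : V → Fin n → ℂ}
    (hz : z ∈ LinearMap.range (G.lapMap (Fin n → ℂ))) :
    closedLoop G A B c K z ∈ LinearMap.range (G.lapMap (Fin n → ℂ)) := by
  obtain ⟨y, rfl⟩ := hz
  exact ⟨_, lapMap_closedLoop G A B c K y⟩

theorem closedLoop_mem_vanishingOnRoots {z : V → Fin n → ℂ}
    (hz : z ∈ G.vanishingOnRoots (Fin n → ℂ)) :
    closedLoop G A B c K z ∈ G.vanishingOnRoots (Fin n → ℂ) := by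
  intro i hi
  rw [closedLoop_apply, hz i hi, G.lapMap_mem_vanishingOnRoots hz i hi]
  simp

theorem closedLoop_apply_of_mem_ker {z : V → Fin n → ℂ}
    (hz : z ∈ LinearMap.ker (G.lapMap (Fin n → ℂ))) (i : V) :
    closedLoop G A B c K z i = complexify A *ᵥ z i := by
  rw [closedLoop_apply, LinearMap.mem_ker.1 hz]
  simp

variable {G A B c K}

theorem closedLoop_eigenvalue_re_neg [DecidableEq V] (hG : HasSpanningTree G.graph)
    (hK : ∀ l ∈ spectrum ℂ (complexify G.laplacian), l ≠ 0 →
      IsHurwitz (complexify A - ((c : ℂ) * l) • complexify (B * K)))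
    (μ : ℂ) (z : V → Fin n → ℂ) (hzU : z ∈ LinearMap.range (G.lapMap (Fin n → ℂ))) (hz0 : z ≠ 0)
    (hz : closedLoop G A B c K z = μ • z) : μ.re < 0 := by
  obtain ⟨l, w, hwU, hw0, hwμ, hwl⟩ := exists_joint_eigenvector
    (S := (closedLoop G A B c K : (V → Fin n → ℂ) →ₗ[ℂ] (V → Fin n → ℂ)))
    (T := G.lapMap (Fin n → ℂ)) (fun z => lapMap_closedLoop G A B c K z)
    (fun z _ => LinearMap.mem_range_self _ z) hzU hz0 hz
  -- Otherwise `w` would lie in both the kernel and the range.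
  have hl : l ≠ 0 := by
    rintro rfl
    exact hw0 (Submodule.disjoint_def.1 (G.disjoint_ker_range_lapMap hG) w
      (by rw [LinearMap.mem_ker, hwl, zero_smul]) hwU)
  -- The joint eigenvector has two slices: fixing the coordinate `k` gives an eigenvector of the
  -- Laplacian for `l`, fixing the node `i` one of `A - c l B K` for `μ`.
  obtain ⟨i, hi⟩ := Function.ne_iff.1 hw0
  obtain ⟨k, hk⟩ := Function.ne_iff.1 hi
  have hlspec : l ∈ spectrum ℂ (complexify G.laplacian) := by
    refine mem_spectrum_of_mulVec_eq_smul (v := fun j => w j k) (Function.ne_iff.2 ⟨i, hk⟩) ?_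
    rw [G.complexify_laplacian_mulVec]
    ext j
    rw [← G.lapMap_pi_apply, hwl]; rfl
  refine hK l hlspec hl μ (mem_spectrum_of_mulVec_eq_smul (v := w i) hi ?_)
  have h : closedLoop G A B c K w i = μ • w i := congrFun hwμ i
  rw [← h, closedLoop_apply, hwl, sub_mulVec, smul_mulVec, Pi.smul_apply, mulVec_smul, smul_smul]

theorem ker_le_decaySubmodule [DecidableEq V] (hA : IsMarginallyStable (complexify A))
    (hA_axis : ∀ μ ∈ spectrum ℂ (complexify A), μ.re = 0) :
    LinearMap.ker (G.lapMap (Fin n → ℂ)) ≤ decaySubmodule (closedLoop G A B c K) 0 := by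
  have hshift : ∀ (μ : ℂ), ∀ z ∈ LinearMap.ker (G.lapMap (Fin n → ℂ)), ∀ i,
      (closedLoop G A B c K - μ • 1) z i =
        (complexify A - μ • (1 : Matrix (Fin n) (Fin n) ℂ)) *ᵥ z i := by
    intro μ z hz i
    change closedLoop G A B c K z i - μ • z i = _
    rw [closedLoop_apply_of_mem_ker G A B c K hz, sub_mulVec, smul_mulVec, one_mulVec]
  have hspec : ∀ (μ : ℂ), ∀ z ∈ LinearMap.ker (G.lapMap (Fin n → ℂ)), ∀ i, z i ≠ 0 →
      closedLoop G A B c K z i = μ • z i → μ ∈ spectrum ℂ (complexify A) := by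
    intro μ z hzU i hi h
    rw [closedLoop_apply_of_mem_ker G A B c K hzU] at h
    exact mem_spectrum_of_mulVec_eq_smul hi h
  refine le_decaySubmodule_zero_of_semisimple
    (fun z hz => closedLoop_mem_ker G A B c K hz) ?_ ?_
  · intro μ z hzU hz0 hz
    obtain ⟨i, hi⟩ := Function.ne_iff.1 hz0
    exact hA_axis μ (hspec μ z hzU i hi (congrFun hz i))
  · intro μ hμ z hzU hz
    ext1 i
    have hzU' : (closedLoop G A B c K - μ • 1) z ∈ LinearMap.ker (G.lapMap (Fin n → ℂ)) :=
      Submodule.sub_mem _ (closedLoop_mem_ker G A B c K hzU) (Submodule.smul_mem _ _ hzU)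
    have hz2 : (complexify A - μ • (1 : Matrix (Fin n) (Fin n) ℂ)) ^ 2 *ᵥ z i = 0 := by
      rw [pow_two, ← mulVec_mulVec, ← hshift μ z hzU, ← hshift μ _ hzU']
      rw [pow_two] at hz
      exact congrFun hz i
    rw [hshift μ z hzU]
    by_cases hμA : μ ∈ spectrum ℂ (complexify A)
    · exact (hA μ hμA).2 hμ (z i) hz2
    -- If `μ` is not an eigenvalue of `A`, then `(A - μ) z i` cannot be an eigenvector, so it is
    -- zero.
    · by_contra hne
      refine hμA (mem_spectrum_of_mulVec_eq_smul hne ?_)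
      rw [pow_two, ← mulVec_mulVec, sub_mulVec, sub_eq_zero, smul_mulVec, one_mulVec] at hz2
      exact hz2

theorem top_le_decaySubmodule [DecidableEq V] (hG : HasSpanningTree G.graph)
    (hA : IsMarginallyStable (complexify A))
    (hA_axis : ∀ μ ∈ spectrum ℂ (complexify A), μ.re = 0) {a : ℝ} (ha : 0 < a)
    (hr : LinearMap.range (G.lapMap (Fin n → ℂ)) ≤ decaySubmodule (closedLoop G A B c K) a) :
    ⊤ ≤ decaySubmodule (closedLoop G A B c K) 0 := by
  rw [← G.ker_sup_range_lapMap hG]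
  exact sup_le (ker_le_decaySubmodule hA hA_axis) (hr.trans (decaySubmodule_anti _ ha.le))

end ClosedLoop

/-! ### Real trajectories as complex ones. -/

section Trajectory

variable {V : Type*} {n m : ℕ}

/-- The complex network state of a real one. -/
def complexState (x : V → Fin n → ℝ) : V → Fin n → ℂ :=
  fun i k => (x i k : ℂ)

theorem norm_complexState_apply (x : V → Fin n → ℝ) (i : V) : ‖complexState x i‖ = ‖x i‖ := by
  simp [Pi.norm_def, complexState]

theorem complexState_apply_injective {x y : V → Fin n → ℝ} {i : V}
    (h : complexState x i = complexState y i) : x i = y i := by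
  ext k
  exact Complex.ofReal_injective (congrFun h k)

theorem continuous_complexState : Continuous (complexState : (V → Fin n → ℝ) → V → Fin n → ℂ) := by
  unfold complexState
  fun_prop

theorem complexState_mulVec_mem_vanishingOnRoots {G : WeightedDigraph V}
    {f : ℝ → V → Fin m → ℝ} (hf : AttacksOnlyNonRoots G.graph f) (B : Matrix (Fin n) (Fin m) ℝ)
    {t : ℝ} (ht : 0 ≤ t) :
    (complexState fun i => B *ᵥ f t i) ∈ G.vanishingOnRoots (Fin n → ℂ) := by
  intro i hi
  ext k
  simp [complexState, hf i hi t ht]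

variable [Fintype V]

theorem norm_complexState (x : V → Fin n → ℝ) : ‖complexState x‖ = ‖x‖ := by
  simp only [Pi.norm_def (f := complexState x), Pi.norm_def (f := x)]
  congr 2
  ext i
  exact norm_complexState_apply x i

/-- The minus sign arises because the protocol sums `x j - x i`, the Laplacian `x i - x j`. -/
theorem lapMap_complexState (G : WeightedDigraph V) (x : V → Fin n → ℝ) (i : V) :
    G.lapMap (Fin n → ℂ) (complexState x) i =
      fun k => ((-(∑ j, G.weight i j • (x j - x i)) : Fin n → ℝ) k : ℂ) := by
  ext k
  rw [G.lapMap_pi_apply, G.lapMap_apply]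
  simp only [complexState, Pi.neg_apply, Finset.sum_apply, Pi.smul_apply, Pi.sub_apply, smul_eq_mul,
    ← Finset.sum_neg_distrib, Complex.ofReal_sum]
  refine Finset.sum_congr rfl fun j _ => ?_
  push_cast; ring

theorem IsTrajectory.hasDerivAt_complexState {G : WeightedDigraph V}
    {A : Matrix (Fin n) (Fin n) ℝ} {B : Matrix (Fin n) (Fin m) ℝ} {c : ℝ}
    {K : Matrix (Fin m) (Fin n) ℝ} {f : ℝ → V → Fin m → ℝ} {x : ℝ → V → Fin n → ℝ}
    (hx : IsTrajectory G A B c K f x) :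
    ∃ S : Set ℝ, S.Countable ∧ ∀ t, 0 < t → t ∉ S →
      HasDerivAt (fun s => complexState (x s))
        (closedLoop G A B c K (complexState (x t)) + complexState fun i => B *ᵥ f t i) t := by
  obtain ⟨-, S, hS, hd⟩ := hx
  refine ⟨S, hS, fun t ht htS => hasDerivAt_pi.2 fun i => hasDerivAt_pi.2 fun k => ?_⟩
  refine (hasDerivAt_pi.1 (hd t ht htS i) k).ofReal_comp.congr_deriv ?_
  change (((A *ᵥ x t i + B *ᵥ controlInput G c K (f t) (x t) i) k : ℝ) : ℂ) =
    (complexify A *ᵥ fun l => (x t i l : ℂ)) k -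
      (c : ℂ) * (complexify (B * K) *ᵥ G.lapMap (Fin n → ℂ) (complexState (x t)) i) k +
      (((B *ᵥ f t i) k : ℝ) : ℂ)
  rw [lapMap_complexState, complexify_mulVec, complexify_mulVec, controlInput, mulVec_add,
    mulVec_smul, mulVec_neg, mulVec_mulVec]
  simp only [Pi.add_apply, Pi.smul_apply, Pi.neg_apply, smul_eq_mul]
  push_cast; ring

/-- The root nodes follow the attack-free flow. -/
theorem IsTrajectory.complexState_root {G : WeightedDigraph V}
    {A : Matrix (Fin n) (Fin n) ℝ} {B : Matrix (Fin n) (Fin m) ℝ} {c : ℝ}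
    {K : Matrix (Fin m) (Fin n) ℝ} {f : ℝ → V → Fin m → ℝ} {x : ℝ → V → Fin n → ℝ}
    (hx : IsTrajectory G A B c K f x) (hf : AttacksOnlyNonRoots G.graph f) {i : V}
    (hi : i ∈ rootNodes G.graph) {t : ℝ} (ht : 0 ≤ t) :
    complexState (x t) i = expFlow (closedLoop G A B c K) t (complexState (x 0)) i := by
  obtain ⟨S, hS, hd⟩ := hx.hasDerivAt_complexState
  exact map_eq_map_expFlow_of_forcing_mem (U := G.vanishingOnRoots (Fin n → ℂ))
    (fun z hz => closedLoop_mem_vanishingOnRoots G A B c K hz)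
    (ContinuousLinearMap.proj (R := ℂ) (φ := fun _ : V => Fin n → ℂ) i) (fun z hz => hz i hi) ht hS
    (continuous_complexState.comp_continuousOn (hx.1.mono Icc_subset_Ici_self))
    (fun s hs => hd s hs.1.1 hs.2)
    (fun s hs => complexState_mulVec_mem_vanishingOnRoots hf B hs.1.le)

end Trajectory

/-! ### The main theorem. -/

theorem corollary2 {V : Type*} [Fintype V] [DecidableEq V] {n m : ℕ}
    (G : WeightedDigraph V) (hG : HasSpanningTree G.graph)
    (A : Matrix (Fin n) (Fin n) ℝ) (B : Matrix (Fin n) (Fin m) ℝ)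
    (K : Matrix (Fin m) (Fin n) ℝ) (c : ℝ) (hc : 0 < c)
    (hA : IsMarginallyStable (complexify A))
    (hA_axis : ∀ μ ∈ spectrum ℂ (complexify A), μ.re = 0)
    (hK : ∀ l ∈ spectrum ℂ (complexify G.laplacian), l ≠ 0 →
      IsHurwitz (complexify A - ((c : ℂ) * l) • complexify (B * K))) :
    ∃ C : ℝ, ∀ (f : ℝ → V → Fin m → ℝ) (x : ℝ → V → Fin n → ℝ),
      AttacksOnlyNonRoots G.graph f → IsTrajectory G A B c K f x →
        -- every bounded attack, whatever its size and energy, leaves all agents stable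
        (StaysBounded f → StaysBounded x) ∧
        -- the effect is at most proportional to the size of the attack signal so far
        (∀ T M : ℝ, 0 ≤ T → (∀ s ∈ Icc 0 T, ∀ j, ‖f s j‖ ≤ M) →
          ∀ t ∈ Icc 0 T, ∀ i, ‖x t i‖ ≤ C * (‖x 0‖ + M)) ∧
        -- the root nodes remain stable and unaffected under every attack, bounded or not
        (∀ i ∈ rootNodes G.graph, ∀ t, 0 ≤ t → ‖x t i‖ ≤ C * ‖x 0‖) ∧
        (∀ x' : ℝ → V → Fin n → ℝ, IsTrajectory G A B c K (fun _ _ => 0) x' → x' 0 = x 0 →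
          ∀ i ∈ rootNodes G.graph, ∀ t, 0 ≤ t → x t i = x' t i) := by
  obtain ⟨a, ha, hdecay⟩ := exists_decay_of_eigenvalues_re_neg
    (fun z hz => closedLoop_mem_range G A B c K hz) (closedLoop_eigenvalue_re_neg hG hK)
  obtain ⟨C₁, hC₁, hflow⟩ := exists_uniform_decay hdecay
  obtain ⟨C₀, hC₀, hfree⟩ := exists_uniform_decay (top_le_decaySubmodule hG hA hA_axis ha hdecay)
  replace hfree : ∀ z t, 0 ≤ t → ‖expFlow (closedLoop G A B c K) t z‖ ≤ C₀ * ‖z‖ := by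
    intro z t ht
    simpa using hfree z trivial t ht
  set β : ℝ := ‖LinearMap.toContinuousLinearMap B.mulVecLin‖ with hβ
  have hβ0 : 0 ≤ β := norm_nonneg _
  have hB : ∀ u, ‖B *ᵥ u‖ ≤ β * ‖u‖ :=
    fun u => (LinearMap.toContinuousLinearMap B.mulVecLin).le_opNorm u
  have hgain : 0 ≤ C₁ * β / a := by positivity
  -- Some node is needed to conclude `0 ≤ M` from the bound on the attack.
  obtain ⟨r, -⟩ := hG.rootNodes_nonempty
  -- `C₀` bounds the free flow, `C₁ * β / a` the response to the forcing `B f`.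
  refine ⟨C₀ + C₁ * β / a, fun f x hf hx => ?_⟩
  have hbound : ∀ T M : ℝ, 0 ≤ T → (∀ s ∈ Icc 0 T, ∀ j, ‖f s j‖ ≤ M) →
      ∀ t ∈ Icc 0 T, ∀ i, ‖x t i‖ ≤ (C₀ + C₁ * β / a) * (‖x 0‖ + M) := by
    intro T M hT hM t ht i
    have hM0 : 0 ≤ M := (norm_nonneg _).trans (hM 0 ⟨le_rfl, hT⟩ r)
    obtain ⟨S, hS, hd⟩ := hx.hasDerivAt_complexState
    have h := norm_sub_expFlow_le hC₁ ha (mul_nonneg hβ0 hM0) hflow ht.1 hS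
      (continuous_complexState.comp_continuousOn (hx.1.mono Icc_subset_Ici_self))
      (fun s hs => hd s hs.1.1 hs.2)
      (fun s hs => G.vanishingOnRoots_le_range hG
        (complexState_mulVec_mem_vanishingOnRoots hf B hs.1))
      (fun s hs => by
        rw [norm_complexState]
        exact (pi_norm_le_iff_of_nonneg (mul_nonneg hβ0 hM0)).2 fun j => (hB _).trans
          (mul_le_mul_of_nonneg_left (hM s ⟨hs.1, hs.2.trans ht.2⟩ j) hβ0))
    have h0 := hfree (complexState (x 0)) t ht.1
    rw [norm_complexState] at h0
    have h1 : ‖x t i‖ ≤ ‖complexState (x t)‖ := by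
      rw [norm_complexState]; exact norm_le_pi_norm _ i
    have h2 := norm_le_norm_add_norm_sub' (complexState (x t))
      (expFlow (closedLoop G A B c K) t (complexState (x 0)))
    have h3 : C₁ * (β * M) / a = C₁ * β / a * M := by ring
    -- The nonnegative cross terms complete the product `(C₀ + C₁ * β / a) * (‖x 0‖ + M)`.
    have h4 := mul_nonneg hC₀ hM0
    have h5 := mul_nonneg hgain (norm_nonneg (x 0))
    rw [h3] at h
    change ‖complexState (x t) - _‖ ≤ _ at h
    simp only [Function.comp_apply] at h
    linarith
  refine ⟨?_, hbound, ?_, ?_⟩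
  · rintro ⟨M, hM⟩
    -- Taking `T = t` works since the bound does not depend on `T`.
    exact ⟨_, fun t ht i => hbound t M ht (fun s hs j => hM s hs.1 j) t ⟨ht, le_rfl⟩ i⟩
  · intro i hi t ht
    rw [← norm_complexState_apply, hx.complexState_root hf hi ht]
    refine (norm_le_pi_norm _ i).trans ((hfree _ t ht).trans ?_)
    rw [norm_complexState]
    exact mul_le_mul_of_nonneg_right (by linarith) (norm_nonneg _)
  · intro x' hx' h0 i hi t ht
    apply complexState_apply_injective
    rw [hx.complexState_root hf hi ht, hx'.complexState_root (fun _ _ _ _ => rfl) hi ht, h0]
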